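/- A ring $R$ with identity (not necessarily commutative) is said to fully realize a group $G$ if $R^\times \cong G$ and, under this identification, every group endomorphism of $G$ is the restriction to $R^\times$ of some unital ring endomorphism of $R$; a group is fully realizable if some ring fully realizes it. Let $n$ be a positive integer and let $\mathbf{S}_n$ be the symmetric group on $n$ letters. The following are equivalent: (1) $n = 1$ or $n = 2$; (2) $\mathbf{S}_n$ is fully realizable; (3) $\mathbf{S}_n$ is simple, in the sense that its only normal subgroups are the trivial subgroup and $\mathbf{S}_n$ itself (here the trivial group $\mathbf{S}_1$ is admitted). -/

import Mathlib

universe u v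

/-- The ring `R` (with identity, not necessarily commutative) fully realizes the group `G`: under
some identification `e` of the unit group `Rˣ` with `G`, every group endomorphism of `G` is induced
by a (unital) ring endomorphism of `R`. -/
def FullyRealizes (R : Type u) [Ring R] (G : Type v) [Group G] : Prop :=
  ∃ e : Rˣ ≃* G, ∀ f : G →* G, ∃ φ : R →+* R,
    ∀ x : Rˣ, e (Units.map (φ : R →* R) x) = f (e x)

/-- The group `G` is fully realizable: some ring (with carrier in `Type u`) fully realizes it. -/
def FullyRealizable (G : Type v) [Group G] : Prop :=
  ∃ (R : Type u) (_ : Ring R), FullyRealizes R G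

/-- The only normal subgroups of `G` are the trivial one and `G` itself. Unlike `IsSimpleGroup`,
this admits the trivial group; for nontrivial groups the two notions agree. -/
def HasOnlyTrivialNormalSubgroups (G : Type v) [Group G] : Prop :=
  ∀ N : Subgroup G, N.Normal → N = ⊥ ∨ N = ⊤

/-!
The units of a ring `R` fully realizing a nontrivial group contain `-1`, and extending the trivial
endomorphism to `R` shows `-1 = 1`, so `R` has characteristic two. If the group is a symmetric
group on at least three letters, let `a = (i j)`, `b = (j k)` and let `N` be the sum in `R` of the
six elements of `⟨a, b⟩`. Then `N ^ 2 = 6 N = 0`, so `1 + N` is a unit, that is, a permutation `c`.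
It is not the identity, as the ring endomorphism extending the endomorphism that sends every
transposition to `a` maps `N` to `3 (1 + a) = 1 + a ≠ 0`. But `c` commutes with every transposition
preserving `{i, j, k}`, which forces `c = (l m)` where `l` and `m` are the only other letters, and
`N = 1 + c`.

Now `(1 + c) (1 + a) = N + N a = 0` since `N a = N`, and conjugating by `(k m)` gives
`(1 + e) (1 + a) = 0` with `e = (k l)`. As `N` is a right multiple of `1 + a`, also
`(1 + e) (1 + c) = (1 + e) N = 0`, which is impossible for the non-commuting involutions
`e` and `c`.

For at most two letters, `ZMod 2` realizes the trivial group and `DualNumber (ZMod 2)` the group of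
order two, the trivial endomorphism being induced by `x + y ε ↦ x`.
-/

section DihedralSum

variable {R : Type*} [Ring R] {a b : R}

/-- The sum of the six elements of the symmetric group on three letters, presented by the two
generating involutions `a` and `b`. -/
def dihedralSum (a b : R) : R :=
  1 + a + b + a * b + b * a + a * b * a

theorem dihedralSum_eq_one_add_mul : dihedralSum a b = (1 + a) * (1 + b + b * a) := by
  rw [dihedralSum]
  noncomm_ring

theorem dihedralSum_eq_mul_one_add : dihedralSum a b = (1 + b + a * b) * (1 + a) := by
  rw [dihedralSum]
  noncomm_ring

theorem dihedralSum_comm (hab : a * b * a = b * a * b) : dihedralSum a b = dihedralSum b a := by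
  rw [dihedralSum, dihedralSum, hab]
  abel

theorem mul_dihedralSum (ha : a * a = 1) : a * dihedralSum a b = dihedralSum a b := by
  rw [dihedralSum_eq_one_add_mul, ← mul_assoc, mul_add a, mul_one, ha, add_comm a]

theorem dihedralSum_mul (ha : a * a = 1) : dihedralSum a b * a = dihedralSum a b := by
  rw [dihedralSum_eq_mul_one_add, mul_assoc, add_mul 1 a, one_mul, ha, add_comm a]

theorem commute_dihedralSum_left (ha : a * a = 1) : Commute a (dihedralSum a b) :=
  (mul_dihedralSum ha).trans (dihedralSum_mul ha).symm

theorem commute_dihedralSum_right (hb : b * b = 1) (hab : a * b * a = b * a * b) :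
    Commute b (dihedralSum a b) :=
  dihedralSum_comm hab ▸ commute_dihedralSum_left hb

theorem commute_dihedralSum_of_commute {g : R} (ha : Commute g a) (hb : Commute g b) :
    Commute g (dihedralSum a b) := by
  have hab := ha.mul_right hb
  exact (((((Commute.one_right g).add_right ha).add_right hb).add_right hab).add_right
    (hb.mul_right ha)).add_right (hab.mul_right ha)

theorem map_dihedralSum {S : Type*} [Ring S] (φ : R →+* S) :
    φ (dihedralSum a b) = dihedralSum (φ a) (φ b) := by
  simp only [dihedralSum, map_add, map_mul, map_one]

variable [CharP R 2]

theorem one_add_mul_one_add_self (ha : a * a = 1) : (1 + a) * (1 + a) = 0 := by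
  rw [mul_add, mul_one, add_mul, one_mul, ha, add_comm a, CharTwo.add_self_eq_zero]

theorem dihedralSum_mul_self (ha : a * a = 1) : dihedralSum a b * dihedralSum a b = 0 := by
  nth_rw 1 [dihedralSum_eq_mul_one_add]
  rw [dihedralSum_eq_one_add_mul, mul_assoc, ← mul_assoc (1 + a), one_add_mul_one_add_self ha,
    zero_mul, mul_zero]

theorem dihedralSum_self (ha : a * a = 1) : dihedralSum a a = 1 + a := by
  rw [dihedralSum_eq_one_add_mul, ha, add_right_comm, CharTwo.add_self_eq_zero, zero_add, add_mul,
    one_mul, ha, add_comm]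

theorem dihedralSum_ne_zero {φ : R →+* R} (ha : a * a = 1) (ha1 : a ≠ 1) (hφa : φ a = a)
    (hφb : φ b = a) : dihedralSum a b ≠ 0 := by
  intro h
  have h1 : 1 + a = 0 := by
    rw [← dihedralSum_self ha, ← map_zero φ, ← h, map_dihedralSum, hφa, hφb]
  exact ha1 (CharTwo.add_eq_zero.mp h1).symm

theorem eq_of_one_add_mul_one_add_eq_zero (ha : a * a = 1) (hb : b * b = 1)
    (hab : a * b * a = b * a * b) (h : (1 + a) * (1 + b) = 0) : a = b := by
  have h_mul : a * b = 1 + a + b := by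
    rw [← CharTwo.add_eq_zero, ← h]
    noncomm_ring
  have h_aba : a * b * a = 1 + a + b * a := by
    rw [h_mul, add_mul, add_mul, ha, one_mul, add_comm a]
  have h_bab : b * a * b = 1 + b + b * a := by
    rw [mul_assoc, h_mul, mul_add, mul_add, hb, mul_one, add_comm, ← add_assoc]
  rw [h_aba, h_bab] at hab
  exact add_left_cancel (add_right_cancel hab)

end DihedralSum

section Transpositions

open Equiv

variable {α : Type*} [DecidableEq α] {c : Perm α} {i j k l m : α}

theorem swap_braid (hij : i ≠ j) (hik : i ≠ k) (hjk : j ≠ k) :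
    swap i j * swap j k * swap i j = swap j k * swap i j * swap j k := by
  rw [swap_mul_swap_mul_swap hij hik, swap_comm i j, swap_comm j k,
    swap_mul_swap_mul_swap hjk.symm hik.symm, swap_comm]

theorem apply_eq_or_eq_of_commute_swap (hij : i ≠ j) (hc : Commute c (swap i j)) :
    c i = i ∨ c i = j := by
  have hcj : c j = swap i j (c i) := by
    simpa only [Perm.mul_apply, swap_apply_left] using DFunLike.congr_fun hc.eq i
  by_contra! h
  rw [swap_apply_of_ne_of_ne h.1 h.2] at hcj
  exact hij (c.injective hcj.symm)

theorem apply_eq_of_commute_swap (hij : i ≠ j) (hik : i ≠ k) (hjk : j ≠ k)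
    (hj : Commute c (swap i j)) (hk : Commute c (swap i k)) : c i = i := by
  have := apply_eq_or_eq_of_commute_swap hij hj
  have := apply_eq_or_eq_of_commute_swap hik hk
  grind

theorem exists_eq_swap_of_commute_swap (hij : i ≠ j) (hik : i ≠ k) (hjk : j ≠ k)
    (hc_ij : Commute c (swap i j)) (hc_jk : Commute c (swap j k))
    (hc : ∀ x y, [i, j, k, x, y].Nodup → Commute c (swap x y)) (hc_ne : c ≠ 1) :
    ∃ l m, [i, j, k, l, m].Nodup ∧ c = swap l m := by
  have hc_ik : Commute c (swap i k) := by
    rw [swap_comm, ← swap_mul_swap_mul_swap hij hik]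
    exact (hc_jk.mul_right hc_ij).mul_right hc_jk
  have hi : c i = i := apply_eq_of_commute_swap hij hik hjk hc_ij hc_ik
  have hj : c j = j :=
    apply_eq_of_commute_swap hij.symm hjk hik (swap_comm i j ▸ hc_ij) hc_jk
  have hk : c k = k :=
    apply_eq_of_commute_swap hik.symm hjk.symm hij (swap_comm i k ▸ hc_ik) (swap_comm j k ▸ hc_jk)
  obtain ⟨l, hl⟩ : ∃ l, c l ≠ l := not_forall.mp fun h => hc_ne (Perm.ext h)
  have hl_mem : l ∉ [i, j, k] := by grind
  have hcl_mem : c l ∉ [i, j, k] := by grind [c.injective.eq_iff]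
  refine ⟨l, c l, by grind, Perm.ext fun x => ?_⟩
  by_cases hx : x ∈ [i, j, k]
  · rw [swap_apply_of_ne_of_ne (by grind) (by grind)]
    grind
  obtain rfl | hxl := eq_or_ne x l
  · rw [swap_apply_left]
  have hx_eq : x = c l :=
    ((apply_eq_or_eq_of_commute_swap hxl.symm (hc l x (by grind))).resolve_left hl).symm
  have hx_apply := apply_eq_or_eq_of_commute_swap hxl (hc x l (by grind))
  rw [hx_eq, swap_apply_right]
  exact (hx_eq ▸ hx_apply).resolve_left (c.injective.ne hl)

variable {R : Type*} [Ring R] {ι : Perm α →* R}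

theorem map_swap_mul_self : ι (swap i j) * ι (swap i j) = 1 := by
  rw [← map_mul, swap_mul_self, map_one]

theorem map_swap_braid (hij : i ≠ j) (hik : i ≠ k) (hjk : j ≠ k) :
    ι (swap i j) * ι (swap j k) * ι (swap i j) = ι (swap j k) * ι (swap i j) * ι (swap j k) := by
  simp only [← map_mul, swap_braid hij hik hjk]

theorem one_add_map_swap_mul_one_add_map_swap_eq_zero (g : Perm α)
    (h : (1 + ι (swap i j)) * (1 + ι (swap k l)) = 0) :
    (1 + ι (swap (g i) (g j))) * (1 + ι (swap (g k) (g l))) = 0 := by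
  have h_semiconj (x y : α) : SemiconjBy (ι g) (1 + ι (swap x y)) (1 + ι (swap (g x) (g y))) :=
    (SemiconjBy.one_right _).add_right (SemiconjBy.map (mul_swap_eq_swap_mul g x y) ι)
  rw [← ((Group.isUnit g).map ι).mul_left_eq_zero,
    ← ((h_semiconj i j).mul_right (h_semiconj k l)).eq, h, mul_zero]

variable [CharP R 2]

theorem exists_dihedralSum_eq_one_add_map_swap (hι : Function.Injective ι)
    (hι_units : ∀ x, IsUnit x → x ∈ Set.range ι) (hij : i ≠ j) (hik : i ≠ k) (hjk : j ≠ k)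
    (hN : dihedralSum (ι (swap i j)) (ι (swap j k)) ≠ 0) :
    ∃ l m, [i, j, k, l, m].Nodup ∧
      dihedralSum (ι (swap i j)) (ι (swap j k)) = 1 + ι (swap l m) := by
  have hN_nilpotent : IsNilpotent (dihedralSum (ι (swap i j)) (ι (swap j k))) :=
    ⟨2, (sq _).trans (dihedralSum_mul_self map_swap_mul_self)⟩
  obtain ⟨c, hc⟩ := hι_units _ hN_nilpotent.isUnit_one_add
  have commute_c {g : Perm α} (hg : Commute (ι g) (dihedralSum (ι (swap i j)) (ι (swap j k)))) :
      Commute c g :=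
    .of_map hι (hc ▸ (Commute.one_right _).add_right hg).symm
  have hc_ne : c ≠ 1 := by
    rintro rfl
    exact hN (by simpa only [map_one, left_eq_add] using hc)
  obtain ⟨l, m, hnodup, rfl⟩ := exists_eq_swap_of_commute_swap hij hik hjk
    (commute_c (commute_dihedralSum_left map_swap_mul_self))
    (commute_c (commute_dihedralSum_right map_swap_mul_self (map_swap_braid hij hik hjk)))
    (fun x y hxy => commute_c (commute_dihedralSum_of_commute
      ((Perm.disjoint_swap_swap (by grind)).commute.map ι)
      ((Perm.disjoint_swap_swap (by grind)).commute.map ι))) hc_ne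
  exact ⟨l, m, hnodup, by rw [hc, CharTwo.add_cancel_left]⟩

theorem dihedralSum_ne_one_add_map_swap (hι : Function.Injective ι)
    (hnodup : [i, j, k, l, m].Nodup) :
    dihedralSum (ι (swap i j)) (ι (swap j k)) ≠ 1 + ι (swap l m) := by
  intro hN
  have h_lm_ij : (1 + ι (swap l m)) * (1 + ι (swap i j)) = 0 := by
    rw [mul_add, mul_one, ← hN, dihedralSum_mul map_swap_mul_self, CharTwo.add_self_eq_zero]
  have h_kl_ij : (1 + ι (swap k l)) * (1 + ι (swap i j)) = 0 := by
    have h := one_add_map_swap_mul_one_add_map_swap_eq_zero (swap k m) h_lm_ij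
    rwa [swap_apply_right, swap_apply_of_ne_of_ne (x := l) (by grind) (by grind),
      swap_apply_of_ne_of_ne (x := i) (by grind) (by grind),
      swap_apply_of_ne_of_ne (x := j) (by grind) (by grind), swap_comm l k] at h
  have h_kl_lm : (1 + ι (swap k l)) * (1 + ι (swap l m)) = 0 := by
    rw [← hN, dihedralSum_eq_one_add_mul, ← mul_assoc, h_kl_ij, zero_mul]
  have h_swap : swap k l = swap l m := hι <| eq_of_one_add_mul_one_add_eq_zero
    map_swap_mul_self map_swap_mul_self (map_swap_braid (by grind) (by grind) (by grind)) h_kl_lm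
  have h_apply : swap k l k = swap l m k := by rw [h_swap]
  rw [swap_apply_left, swap_apply_of_ne_of_ne (by grind) (by grind)] at h_apply
  grind

end Transpositions

section FullyRealizes

variable {R G : Type*} [Ring R] [Group G]

theorem FullyRealizes.exists_monoidHom (h : FullyRealizes R G) :
    ∃ ι : G →* R, Function.Injective ι ∧ (∀ x, IsUnit x → x ∈ Set.range ι) ∧
      ∀ f : G →* G, ∃ φ : R →+* R, ∀ g, φ (ι g) = ι (f g) := by
  obtain ⟨e, he⟩ := h
  refine ⟨(Units.coeHom R).comp e.symm, Units.val_injective.comp e.symm.injective, ?_, fun f => ?_⟩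
  · rintro _ ⟨u, rfl⟩
    exact ⟨e u, congrArg Units.val (e.symm_apply_apply u)⟩
  · obtain ⟨φ, hφ⟩ := he f
    refine ⟨φ, fun g => ?_⟩
    have hg : Units.map (φ : R →* R) (e.symm g) = e.symm (f g) := by
      rw [MulEquiv.eq_symm_apply, hφ, e.apply_symm_apply]
    exact congrArg Units.val hg

theorem FullyRealizes.charP_two [Nontrivial G] (h : FullyRealizes R G) : CharP R 2 := by
  obtain ⟨ι, hι, hι_units, hι_extend⟩ := h.exists_monoidHom
  have : Nontrivial R := hι.nontrivial
  obtain ⟨g, hg⟩ := hι_units (-1) isUnit_one.neg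
  obtain ⟨φ, hφ⟩ := hι_extend 1
  have h_neg : (-1 : R) = 1 := by
    simpa only [hg, map_neg, map_one, MonoidHom.one_apply] using hφ g
  refine CharTwo.of_one_ne_zero_of_two_eq_zero one_ne_zero ?_
  rw [← one_add_one_eq_two, ← eq_neg_iff_add_eq_zero, h_neg]

theorem exists_monoidHom_units_int_apply_neg_one {t : G} (ht : t * t = 1) :
    ∃ f : ℤˣ →* G, f (-1) = t := by
  refine ⟨MonoidHom.mk' (fun s => if s = 1 then 1 else t) fun r s => ?_, by simp⟩
  rcases Int.units_eq_one_or r with rfl | rfl <;> rcases Int.units_eq_one_or s with rfl | rfl <;>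
    simp [ht]

theorem FullyRealizes.fullyRealizable {R : Type v} [Ring R] (h : FullyRealizes R G) :
    FullyRealizable.{max u v} G := by
  obtain ⟨e, he⟩ := h
  let E : ULift.{u} R ≃+* R := ULift.ringEquiv
  refine ⟨ULift.{u} R, inferInstance, (Units.mapEquiv E.toMulEquiv).trans e, fun f => ?_⟩
  obtain ⟨φ, hφ⟩ := he f
  refine ⟨(E.symm : R →+* ULift R).comp (φ.comp (E : ULift R →+* R)), fun x => ?_⟩
  rw [MulEquiv.trans_apply, MulEquiv.trans_apply, ← hφ]
  rfl

theorem fullyRealizes_of_subsingleton [Subsingleton Rˣ] [Subsingleton G] : FullyRealizes R G :=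
  ⟨⟨⟨1, 1, fun _ => Subsingleton.elim _ _, fun _ => Subsingleton.elim _ _⟩,
    fun _ _ => Subsingleton.elim _ _⟩, fun _ => ⟨RingHom.id R, fun _ => Subsingleton.elim _ _⟩⟩

theorem eq_one_or_eq_id_of_card_eq_two (hG : Nat.card G = 2) (f : G →* G) :
    f = 1 ∨ f = MonoidHom.id G := by
  obtain ⟨t, -, ht⟩ := (Nat.card_eq_two_iff' (1 : G)).mp hG
  by_cases hft : f t = 1
  · left
    ext g
    obtain rfl | hg := eq_or_ne g 1
    · rw [map_one, map_one]
    · rw [ht g hg, hft, MonoidHom.one_apply]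
  · right
    ext g
    obtain rfl | hg := eq_or_ne g 1
    · rw [map_one, map_one]
    · rw [ht g hg, ht _ hft, MonoidHom.id_apply]

theorem units_map_comp_eq_one {S T : Type*} [Ring S] [Ring T] [Subsingleton Sˣ] (p : R →+* S)
    (s : S →+* T) (u : Rˣ) : Units.map (s.comp p : R →* T) u = 1 := by
  have h_p : Units.map (p : R →* S) u = 1 := Subsingleton.elim _ _
  exact (congrArg (Units.map (s : S →* T)) h_p).trans (map_one _)

theorem card_units_dualNumber_zmod_two : Nat.card (DualNumber (ZMod 2))ˣ = 2 := by
  let _ : Fintype (DualNumber (ZMod 2)) := inferInstanceAs (Fintype (ZMod 2 × ZMod 2))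
  let _ : DecidableEq (DualNumber (ZMod 2)) := inferInstanceAs (DecidableEq (ZMod 2 × ZMod 2))
  rw [Nat.card_eq_fintype_card]
  decide

theorem fullyRealizes_dualNumber_zmod_two (hG : Nat.card G = 2) :
    FullyRealizes (DualNumber (ZMod 2)) G := by
  refine ⟨mulEquivOfPrimeCardEq card_units_dualNumber_zmod_two hG, fun f => ?_⟩
  obtain rfl | rfl := eq_one_or_eq_id_of_card_eq_two hG f
  · refine ⟨(TrivSqZeroExt.inlHom (ZMod 2) (ZMod 2)).comp
      (TrivSqZeroExt.fstHom ℕ (ZMod 2) (ZMod 2)).toRingHom, fun u => ?_⟩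
    rw [units_map_comp_eq_one, map_one, MonoidHom.one_apply]
  · exact ⟨RingHom.id _, fun _ => rfl⟩

end FullyRealizes

section FinitePerm

open Equiv

variable {α : Type*} [Fintype α]

theorem nat_card_perm_eq_two (hα : Fintype.card α = 2) : Nat.card (Perm α) = 2 := by
  rw [Nat.card_perm, Nat.card_eq_fintype_card, hα, Nat.factorial_two]

theorem not_fullyRealizes_perm {R : Type*} [Ring R] (hα : 2 < Fintype.card α) :
    ¬ FullyRealizes R (Perm α) := by
  classical
  intro h
  obtain ⟨i, j, k, hij, hik, hjk⟩ := Fintype.two_lt_card_iff.mp hα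
  have : Nontrivial α := ⟨i, j, hij⟩
  have := h.charP_two
  obtain ⟨ι, hι, hι_units, hι_extend⟩ := h.exists_monoidHom
  obtain ⟨f, hf⟩ := exists_monoidHom_units_int_apply_neg_one (swap_mul_self i j)
  obtain ⟨φ, hφ⟩ := hι_extend (f.comp Perm.sign)
  have hφ_swap {x y : α} (hxy : x ≠ y) : φ (ι (swap x y)) = ι (swap i j) := by
    rw [hφ, MonoidHom.comp_apply, Perm.sign_swap hxy, hf]
  have h_ne_one : ι (swap i j) ≠ 1 := by
    rw [← map_one ι, hι.ne_iff, Ne, swap_eq_one_iff]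
    exact hij
  obtain ⟨l, m, hnodup, hN⟩ := exists_dihedralSum_eq_one_add_map_swap hι hι_units hij hik hjk
    (dihedralSum_ne_zero map_swap_mul_self h_ne_one (hφ_swap hij) (hφ_swap hjk))
  exact dihedralSum_ne_one_add_map_swap hι hnodup hN

theorem fullyRealizable_perm_iff : FullyRealizable.{u} (Perm α) ↔ Fintype.card α ≤ 2 := by
  constructor
  · rintro ⟨R, _, hR⟩
    exact not_lt.mp fun hα => not_fullyRealizes_perm hα hR
  · intro hα
    obtain hα | hα := hα.lt_or_eq
    · have := Fintype.card_le_one_iff_subsingleton.mp (Nat.le_of_lt_succ hα)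
      exact (fullyRealizes_of_subsingleton (R := ZMod 2)).fullyRealizable
    · exact (fullyRealizes_dualNumber_zmod_two (nat_card_perm_eq_two hα)).fullyRealizable

theorem hasOnlyTrivialNormalSubgroups_perm_iff :
    HasOnlyTrivialNormalSubgroups (Perm α) ↔ Fintype.card α ≤ 2 := by
  classical
  constructor
  · intro h
    by_contra! hα
    have : Nontrivial α := Fintype.one_lt_card_iff_nontrivial.mp (by lia)
    have := alternatingGroup.nontrivial_of_three_le_card (α := α)
      (by rwa [Nat.card_eq_fintype_card])
    have h_index := alternatingGroup.index_eq_two (α := α)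
    rw [(h (alternatingGroup α) inferInstance).resolve_left
      ((Subgroup.nontrivial_iff_ne_bot _).mp this), Subgroup.index_top] at h_index
    lia
  · intro hα N hN
    obtain hα | hα := hα.lt_or_eq
    · have := Fintype.card_le_one_iff_subsingleton.mp (Nat.le_of_lt_succ hα)
      exact .inl (Subsingleton.elim _ _)
    · have : IsSimpleGroup (Perm α) := isSimpleGroup_of_prime_card (nat_card_perm_eq_two hα)
      exact hN.eq_bot_or_eq_top

end FinitePerm

theorem mainTheorem3 (n : ℕ) (hn : 1 ≤ n) :
    List.TFAE [
      n = 1 ∨ n = 2,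
      FullyRealizable.{u} (Equiv.Perm (Fin n)),
      HasOnlyTrivialNormalSubgroups (Equiv.Perm (Fin n))] := by
  have h_le : n = 1 ∨ n = 2 ↔ Fintype.card (Fin n) ≤ 2 := by
    rw [Fintype.card_fin]
    lia
  tfae_have 1 ↔ 2 := h_le.trans fullyRealizable_perm_iff.symm
  tfae_have 1 ↔ 3 := h_le.trans hasOnlyTrivialNormalSubgroups_perm_iff.symm
  tfae_finish
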